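/- Let $n\ge 1$ and let $H = H_1 * \dots * H_n$ be a free product of groups $H_i = G_i\times C_i$, where each $G_i$ is a nontrivial finite cyclic group, each $C_i$ is an infinite cyclic group, and the orders $|G_1|,\dots,|G_n|$ are pairwise coprime. Choose generators $a_i$ of $G_i$ and $c_i$ of $C_i$, let $F_i$ be the free group on two letters $x_i,y_i$, and let $F_i\twoheadrightarrow H_i$ be the natural minimal free presentation $x_i\mapsto (a_i,1)$, $y_i\mapsto(1,c_i)$. Let $F = F_1 * \dots * F_n\twoheadrightarrow H$ be the induced epimorphism, let $R$ be its kernel, and let $\overline{R} = R/[R,R]$ be the relation module, that is, the abelian group $R/[R,R]$ viewed as a $\mathbb{Z}H$-module through conjugation in $F$. Then the minimal number $d_H(\overline{R})$ of generators of $\overline{R}$ as a $\mathbb{Z}H$-module is $$d_H(\overline{R}) = n+1.$$ -/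

import Mathlib

namespace RelationModule

section Relation

variable {F H : Type*} [Group F] [Group H]

/-- For a normal subgroup `N` of `F`, the conjugation action of `F` on the abelian group
`N / [N, N]` (written additively): `f` sends the class of `r` to the class of `f * r * f⁻¹`. -/
def conjRep (N : Subgroup F) [N.Normal] :
    Representation ℤ F (Additive (Abelianization N)) where
  toFun f := (MonoidHom.toAdditive
    (Abelianization.map (MulAut.conjNormal f : MulAut N).toMonoidHom)).toIntLinearMap
  map_one' := by
    ext x
    obtain ⟨r, rfl⟩ := QuotientGroup.mk_surjective x.toMul
    change Additive.ofMul (Abelianization.of (MulAut.conjNormal (1 : F) r)) = _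
    rw [map_one]
    rfl
  map_mul' f g := by
    ext x
    obtain ⟨r, rfl⟩ := QuotientGroup.mk_surjective x.toMul
    change Additive.ofMul (Abelianization.of (MulAut.conjNormal (f * g) r)) = _
    rw [map_mul]
    rfl

theorem conjRep_of (N : Subgroup F) [N.Normal] (f : F) (r : N) :
    conjRep N f (Additive.ofMul (Abelianization.of r)) =
      Additive.ofMul (Abelianization.of (MulAut.conjNormal f r)) :=
  rfl

theorem conjRep_eq_one (N : Subgroup F) [N.Normal] {s : F} (hs : s ∈ N) : conjRep N s = 1 := by
  refine LinearMap.ext fun x => ?_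
  obtain ⟨r, hr⟩ := QuotientGroup.mk_surjective x.toMul
  have hx : x = Additive.ofMul (Abelianization.of r) := by
    rw [← ofMul_toMul x, ← hr]
    rfl
  have hc : (MulAut.conjNormal s r : N) = ⟨s, hs⟩ * r * ⟨s, hs⟩⁻¹ := by
    ext
    simp
  have he : Abelianization.of (MulAut.conjNormal s r : N) = Abelianization.of r := by
    rw [hc, map_mul, map_mul, map_inv, mul_right_comm, mul_inv_cancel, one_mul]
  rw [hx, conjRep_of, he]
  rfl

theorem conjRep_eq_of_map_eq (π : F →* H) {f g : F} (h : π f = π g) :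
    conjRep π.ker f = conjRep π.ker g := by
  have hk : g⁻¹ * f ∈ π.ker := by
    rw [MonoidHom.mem_ker, map_mul, map_inv, h, inv_mul_cancel]
  rw [← mul_inv_cancel_left g f, map_mul, conjRep_eq_one _ hk, mul_one]

/-- For a presentation `π : F ↠ H` with kernel `R`, the action of `H` on `R / [R, R]`
induced by conjugation in `F`: `h` acts as any `f` with `π f = h`, so `π f` sends the class of `r`
to the class of `f * r * f⁻¹`. -/
noncomputable def relationRep (π : F →* H) (hπ : Function.Surjective π) :
    Representation ℤ H (Additive (Abelianization π.ker)) where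
  toFun h := conjRep π.ker (Function.surjInv hπ h)
  map_one' := conjRep_eq_one _ (Function.surjInv_eq hπ 1)
  map_mul' h k := by
    rw [← map_mul]
    apply conjRep_eq_of_map_eq
    rw [map_mul, Function.surjInv_eq hπ, Function.surjInv_eq hπ, Function.surjInv_eq hπ]

theorem relationRep_of (π : F →* H) (hπ : Function.Surjective π) (f : F) (r : π.ker) :
    relationRep π hπ (π f) (Additive.ofMul (Abelianization.of r)) =
      Additive.ofMul (Abelianization.of (MulAut.conjNormal f r)) := by
  rw [← conjRep_of, ← conjRep_eq_of_map_eq π (Function.surjInv_eq hπ (π f))]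
  rfl

/-- The relation module `R / [R, R]` of `π : F ↠ H`, `R = ker π`; it carries Mathlib's structure
of a module over `MonoidAlgebra ℤ H` attached to a representation of `H`. -/
noncomputable abbrev RelMod (π : F →* H) (hπ : Function.Surjective π) :=
  (relationRep π hπ).asModule

end Relation

/-- The natural presentation of `G × C` attached to generators `a` of `G` and `c` of `C`:
the free group on two letters, with the first letter sent to `a` and the second to `c`. -/
def naturalPres {G C : Type*} [Group G] [Group C] (a : G) (c : C) :
    FreeGroup (Fin 2) →* G × C :=
  FreeGroup.lift ![(a, 1), (1, c)]

theorem naturalPres_surjective {G C : Type*} [Group G] [Group C] {a : G} {c : C}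
    (ha : Subgroup.zpowers a = ⊤) (hc : Subgroup.zpowers c = ⊤) :
    Function.Surjective (naturalPres a c) := by
  rintro ⟨g, h⟩
  obtain ⟨k, rfl⟩ := Subgroup.mem_zpowers_iff.1 (ha ▸ Subgroup.mem_top g)
  obtain ⟨l, rfl⟩ := Subgroup.mem_zpowers_iff.1 (hc ▸ Subgroup.mem_top h)
  exact ⟨FreeGroup.of 0 ^ k * FreeGroup.of 1 ^ l, by simp [naturalPres]⟩

/-- The homomorphism `*ᵢ Fᵢ → *ᵢ Hᵢ` of free products induced by homomorphisms `Fᵢ → Hᵢ`. -/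
def freeProdMap {ι : Type*} {F H : ι → Type*} [∀ i, Group (F i)] [∀ i, Group (H i)]
    (φ : ∀ i, F i →* H i) : Monoid.CoprodI F →* Monoid.CoprodI H :=
  Monoid.CoprodI.lift fun i => Monoid.CoprodI.of.comp (φ i)

theorem freeProdMap_surjective {ι : Type*} {F H : ι → Type*} [∀ i, Group (F i)]
    [∀ i, Group (H i)] {φ : ∀ i, F i →* H i} (hφ : ∀ i, Function.Surjective (φ i)) :
    Function.Surjective (freeProdMap φ) := by
  intro x
  induction x using Monoid.CoprodI.induction_on with
  | one => exact ⟨1, map_one _⟩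
  | of i m =>
    obtain ⟨f, rfl⟩ := hφ i m
    exact ⟨Monoid.CoprodI.of f, by simp [freeProdMap]⟩
  | mul x y hx hy =>
    obtain ⟨f, rfl⟩ := hx
    obtain ⟨g, rfl⟩ := hy
    exact ⟨f * g, map_mul _ _ _⟩

end RelationModule

/-!
Let `αᵢ` and `βᵢ` be the classes in `R / [R, R]` of the relators `xᵢ ^ mᵢ` and `⁅xᵢ, yᵢ⁆`, where
`mᵢ = |Gᵢ|`, and let `Xᵢ`, `Yᵢ` be the images of `xᵢ`, `yᵢ` in `H`. The `αᵢ` and `βᵢ` generate the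
relation module, and `(Xᵢ - 1) αᵢ = 0`, `(1 + Xᵢ + ⋯ + Xᵢ ^ (mᵢ - 1)) βᵢ = (1 - Yᵢ) αᵢ`.

Upper bound: modulo `γᵢ = αᵢ + (Xᵢ - 1) βᵢ` these relations force `mᵢ² βᵢ = 0`. As the `mᵢ` are
pairwise coprime, `∑ βᵢ = 0` then forces every `βᵢ = 0`, so the `n` elements `γᵢ` together with
`∑ βᵢ` generate.

Lower bound: modulo `m₁` there are `n + 1` homomorphisms on `R` that are invariant under conjugation
by `F` and dual to the relators `xᵢ ^ mᵢ` and `⁅x₁, y₁⁆`: the exponent sums of the `xᵢ` divided by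
`mᵢ`, and the corner entry of the representation of `⟨x₁, y₁⟩` by unitriangular matrices over
`ℤ / m₁`.
-/

namespace RelationModule

open scoped commutatorElement

section Algebra

variable {A M : Type*} [Ring A] [AddCommGroup M] [Module A M]

theorem card_le_spanRank_of_dual {K κ : Type*} [Ring K] [StrongRankCondition K] [Fintype κ]
    [DecidableEq κ] {σ : A →+* K} [RingHomSurjective σ] (f : κ → M →ₛₗ[σ] K) (x : κ → M)
    (hf : ∀ k l, f k (x l) = Pi.single (M := fun _ => K) l 1 k) :
    (Fintype.card κ : Cardinal) ≤ (⊤ : Submodule A M).spanRank := by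
  let Φ : M →ₛₗ[σ] (κ → K) :=
    { toFun y k := f k y
      map_add' y z := funext fun k => map_add (f k) y z
      map_smul' b y := funext fun k => map_smulₛₗ (f k) b y }
  have hΦ : Function.Surjective Φ := fun v => by
    choose b hb using fun k => σ.surjective (v k)
    refine ⟨∑ l, b l • x l, funext fun k => ?_⟩
    change f k (∑ l, b l • x l) = v k
    simp [map_sum, hb, hf, Pi.single_apply]
  have hrank := Submodule.lift_spanRank_map_le Φ ⊤
  rw [Submodule.map_top, LinearMap.range_eq_top.2 hΦ, ← Submodule.rank_eq_spanRank_of_free,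
    rank_fun'] at hrank
  simpa using hrank

theorem eq_zero_of_sum_eq_zero_of_coprime_nsmul {ι : Type*} [Fintype ι] {m : ι → ℕ}
    (hm : Pairwise fun i j => (m i).Coprime (m j)) {β : ι → M} (hβ : ∀ i, m i • β i = 0)
    (hsum : ∑ i, β i = 0) (i : ι) : β i = 0 := by
  classical
  have hindep : iSupIndep fun i => Submodule.torsionBy ℤ M (m i : ℤ) :=
    (Submodule.supIndep_torsionBy (S := Finset.univ)
      fun i _ j _ hij => (hm hij).isCoprime).iSupIndep_of_univ
  refine (iSupIndep_iff_finsetSum_eq_zero_imp_eq_zero _).1 hindep Finset.univ β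
    (fun j _ => ?_) hsum i (Finset.mem_univ i)
  rw [Submodule.mem_torsionBy_iff, natCast_zsmul, hβ]

theorem geom_sum_smul_of_smul_eq {X : A} {v : M} (h : X • v = v) (m : ℕ) :
    (∑ k ∈ Finset.range m, X ^ k) • v = m • v := by
  have hpow (k : ℕ) : X ^ k • v = v := by
    induction k with
    | zero => rw [pow_zero, one_smul]
    | succ k ih => rw [pow_succ, mul_smul, h, ih]
  simp only [Finset.sum_smul, hpow, Finset.sum_const, Finset.card_range]

theorem sq_nsmul_eq_zero_of_add_sub_one_smul_eq_zero {X Y : A} (hXY : Commute X Y) {m : ℕ}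
    {α β : M} (hα : X • α = α) (hβ : (∑ k ∈ Finset.range m, X ^ k) • β = α - Y • α)
    (hγ : α + (X - 1) • β = 0) : m ^ 2 • β = 0 := by
  set N := ∑ k ∈ Finset.range m, X ^ k
  have hα_eq : (X - 1) • β = -α := eq_neg_of_add_eq_zero_right hγ
  have hNcomm : N * (X - 1) = (X - 1) * N := (geom_sum_mul X m).trans (mul_geom_sum X m).symm
  have hmα : m • α = 0 := calc
    m • α = N • α := (geom_sum_smul_of_smul_eq hα m).symm
    _ = -((X - 1) • N • β) := by rw [← mul_smul, ← hNcomm, mul_smul, hα_eq, smul_neg, neg_neg]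
    _ = 0 := by
      rw [hβ, sub_smul, one_smul, smul_sub, ← mul_smul, hXY.eq, mul_smul, hα, sub_self, neg_zero]
  have hXβ : X • m • β = m • β := by
    rw [← sub_eq_zero, ← one_smul A (m • β), ← mul_smul, mul_one, ← sub_smul, smul_comm, hα_eq,
      smul_neg, hmα, neg_zero]
  calc m ^ 2 • β = N • m • β := by rw [geom_sum_smul_of_smul_eq hXβ, pow_two, mul_smul]
    _ = m • α - Y • m • α := by rw [smul_comm, hβ, smul_sub, smul_comm m Y]
    _ = 0 := by rw [hmα, smul_zero, sub_zero]

theorem mem_of_add_sub_one_smul_mem_of_sum_mem {ι : Type*} [Fintype ι] {m : ι → ℕ}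
    (hm : Pairwise fun i j => (m i).Coprime (m j)) {X Y : ι → A}
    (hXY : ∀ i, Commute (X i) (Y i)) {α β : ι → M} (hα : ∀ i, X i • α i = α i)
    (hβ : ∀ i, (∑ k ∈ Finset.range (m i), X i ^ k) • β i = α i - Y i • α i)
    {S : Submodule A M} (hγ : ∀ i, α i + (X i - 1) • β i ∈ S) (hδ : ∑ i, β i ∈ S) (i : ι) :
    α i ∈ S ∧ β i ∈ S := by
  have hγ' (j : ι) : S.mkQ (α j) + (X j - 1) • S.mkQ (β j) = 0 := by
    rw [← map_smul, ← map_add]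
    exact (Submodule.Quotient.mk_eq_zero S).2 (hγ j)
  have htors (j : ι) : m j ^ 2 • S.mkQ (β j) = 0 := by
    refine sq_nsmul_eq_zero_of_add_sub_one_smul_eq_zero (hXY j) ?_ ?_ (hγ' j)
    · rw [← map_smul, hα]
    · rw [← map_smul, hβ, map_sub, map_smul]
  have hsum : ∑ j, S.mkQ (β j) = 0 := by
    rw [← map_sum]
    exact (Submodule.Quotient.mk_eq_zero S).2 hδ
  have hβ0 : S.mkQ (β i) = 0 :=
    eq_zero_of_sum_eq_zero_of_coprime_nsmul (fun _ _ hij => (hm hij).pow 2 2) htors hsum i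
  have hα0 : S.mkQ (α i) = 0 := by simpa only [hβ0, smul_zero, add_zero] using hγ' i
  exact ⟨(Submodule.Quotient.mk_eq_zero S).1 hα0, (Submodule.Quotient.mk_eq_zero S).1 hβ0⟩

end Algebra

section RelationClasses

variable {F H : Type*} [Group F] [Group H] (π : F →* H) (hπ : Function.Surjective π)

/-- The class `r[R, R]` in the relation module of an element `r` of the kernel `R`. -/
noncomputable def relClass (r : π.ker) : RelMod π hπ :=
  (relationRep π hπ).asModuleEquiv.symm (Additive.ofMul (Abelianization.of r))

theorem relClass_surjective : Function.Surjective (relClass π hπ) := fun x =>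
  QuotientGroup.mk_surjective (Additive.toMul ((relationRep π hπ).asModuleEquiv x))

theorem relClass_one : relClass π hπ 1 = 0 := rfl

theorem relClass_mul (r s : π.ker) :
    relClass π hπ (r * s) = relClass π hπ r + relClass π hπ s := rfl

theorem relClass_inv (r : π.ker) : relClass π hπ r⁻¹ = -relClass π hπ r := rfl

theorem relClass_conj (f : F) (r : π.ker) :
    relClass π hπ (MulAut.conjNormal f r) = MonoidAlgebra.of ℤ H (π f) • relClass π hπ r := by
  rw [relClass, relClass, ← relationRep_of π hπ, Representation.asModuleEquiv_symm_map_rho]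

theorem span_relClass_eq_top {T : Set F} (hT : π.ker = Subgroup.normalClosure T) :
    Submodule.span (MonoidAlgebra ℤ H) (relClass π hπ '' (Subtype.val ⁻¹' T)) = ⊤ := by
  set S := Submodule.span (MonoidAlgebra ℤ H) (relClass π hπ '' (Subtype.val ⁻¹' T))
  have hmem (f : F) (hf : f ∈ Subgroup.normalClosure T) :
      ∃ hf' : f ∈ π.ker, relClass π hπ ⟨f, hf'⟩ ∈ S := by
    induction hf using Subgroup.closure_induction with
    | mem f hf =>
      obtain ⟨t, ht, hconj⟩ := Group.mem_conjugatesOfSet_iff.1 hf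
      obtain ⟨g, rfl⟩ := isConj_iff.1 hconj
      let r : π.ker := ⟨t, hT ▸ Subgroup.subset_normalClosure ht⟩
      have hr : relClass π hπ (MulAut.conjNormal g r) ∈ S := by
        rw [relClass_conj]
        exact S.smul_mem _ (Submodule.subset_span ⟨r, ht, rfl⟩)
      exact ⟨(MulAut.conjNormal g r).2, hr⟩
    | one => exact ⟨one_mem _, S.zero_mem⟩
    | mul f g _ _ hf hg =>
      exact ⟨mul_mem hf.choose hg.choose, S.add_mem hf.choose_spec hg.choose_spec⟩
    | inv f _ hf => exact ⟨inv_mem hf.choose, S.neg_mem hf.choose_spec⟩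
  refine top_unique fun v _ => ?_
  obtain ⟨r, rfl⟩ := relClass_surjective π hπ v
  exact (hmem r (hT ▸ r.2)).choose_spec

variable {π}

theorem smul_relClass_pow {x : F} {m : ℕ} (hx : x ^ m ∈ π.ker) :
    MonoidAlgebra.of ℤ H (π x) • relClass π hπ ⟨x ^ m, hx⟩ = relClass π hπ ⟨x ^ m, hx⟩ := by
  rw [← relClass_conj]
  congr 1
  ext
  rw [MulAut.conjNormal_apply]
  exact mul_inv_eq_of_eq_mul (Commute.self_pow x m).eq

theorem commutator_pow_mem_ker {x y : F} (hxy : ⁅x, y⁆ ∈ π.ker) (k : ℕ) :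
    ⁅x ^ k, y⁆ ∈ π.ker := by
  rw [MonoidHom.mem_ker, map_commutatorElement, commutatorElement_eq_one_iff_commute] at hxy ⊢
  rw [map_pow]
  exact hxy.pow_left k

theorem relClass_commutator_pow {x y : F} (hxy : ⁅x, y⁆ ∈ π.ker) (k : ℕ) :
    relClass π hπ ⟨⁅x ^ k, y⁆, commutator_pow_mem_ker hxy k⟩ =
      (∑ j ∈ Finset.range k, MonoidAlgebra.of ℤ H (π x) ^ j) • relClass π hπ ⟨⁅x, y⁆, hxy⟩ := by
  induction k with
  | zero =>
    rw [Finset.range_zero, Finset.sum_empty, zero_smul, ← relClass_one]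
    congr 1
    ext
    simp only [pow_zero, commutatorElement_one_left, OneMemClass.coe_one]
  | succ k ih =>
    rw [geom_sum_succ, add_smul, one_smul, mul_smul, ← ih, ← relClass_conj, ← relClass_mul]
    congr 1
    ext
    simp only [Subgroup.coe_mul, MulAut.conjNormal_apply, commutatorElement_def]
    group

theorem geom_sum_smul_relClass_commutator {x y : F} {m : ℕ} (hx : x ^ m ∈ π.ker)
    (hxy : ⁅x, y⁆ ∈ π.ker) :
    (∑ j ∈ Finset.range m, MonoidAlgebra.of ℤ H (π x) ^ j) • relClass π hπ ⟨⁅x, y⁆, hxy⟩ =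
      relClass π hπ ⟨x ^ m, hx⟩ -
        MonoidAlgebra.of ℤ H (π y) • relClass π hπ ⟨x ^ m, hx⟩ := by
  rw [← relClass_commutator_pow, sub_eq_add_neg, ← relClass_conj, ← relClass_inv, ← relClass_mul]
  congr 1
  ext
  simp only [Subgroup.coe_mul, Subgroup.coe_inv, MulAut.conjNormal_apply, commutatorElement_def]
  group

theorem spanRank_relMod_le {ι : Type*} [Fintype ι] {x y : ι → F} {m : ι → ℕ}
    (hm : Pairwise fun i j => (m i).Coprime (m j))
    (hker : π.ker = Subgroup.normalClosure (⋃ i, {x i ^ m i, ⁅x i, y i⁆})) :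
    (⊤ : Submodule (MonoidAlgebra ℤ H) (RelMod π hπ)).spanRank ≤
      ((Fintype.card ι + 1 : ℕ) : Cardinal) := by
  have hrel (i : ι) : ({x i ^ m i, ⁅x i, y i⁆} : Set F) ⊆ π.ker := fun r hr =>
    hker ▸ Subgroup.subset_normalClosure (Set.mem_iUnion_of_mem i hr)
  have hx (i : ι) : x i ^ m i ∈ π.ker := hrel i (Set.mem_insert _ _)
  have hxy (i : ι) : ⁅x i, y i⁆ ∈ π.ker := hrel i (Set.mem_insert_of_mem _ rfl)
  have hcomm (i : ι) : Commute (π (x i)) (π (y i)) := by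
    rw [← commutatorElement_eq_one_iff_commute, ← map_commutatorElement]
    exact hxy i
  let α (i : ι) := relClass π hπ ⟨x i ^ m i, hx i⟩
  let β (i : ι) := relClass π hπ ⟨⁅x i, y i⁆, hxy i⟩
  let γ (o : Option ι) : RelMod π hπ :=
    o.elim (∑ i, β i) fun i => α i + (MonoidAlgebra.of ℤ H (π (x i)) - 1) • β i
  have hαβ := mem_of_add_sub_one_smul_mem_of_sum_mem hm
    (fun i => (hcomm i).map (MonoidAlgebra.of ℤ H)) (α := α) (β := β)
    (fun i => smul_relClass_pow hπ (hx i))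
    (fun i => geom_sum_smul_relClass_commutator hπ (hx i) (hxy i))
    (S := Submodule.span _ (Set.range γ)) (fun i => Submodule.subset_span ⟨some i, rfl⟩)
    (Submodule.subset_span ⟨none, rfl⟩)
  have hspan : Submodule.span (MonoidAlgebra ℤ H) (Set.range γ) = ⊤ := by
    rw [← top_le_iff, ← span_relClass_eq_top π hπ hker, Submodule.span_le]
    rintro _ ⟨⟨r, hr⟩, hmem, rfl⟩
    obtain ⟨i, rfl | rfl⟩ := Set.mem_iUnion.1 hmem
    · exact (hαβ i).1
    · exact (hαβ i).2
  calc (⊤ : Submodule (MonoidAlgebra ℤ H) (RelMod π hπ)).spanRank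
      ≤ Cardinal.mk (Set.range γ) := hspan ▸ Submodule.spanRank_span_le_card _
    _ ≤ ((Fintype.card ι + 1 : ℕ) : Cardinal) := by
      rw [← Cardinal.lift_le]
      simpa using Cardinal.mk_range_le_lift (f := γ)

end RelationClasses

section InvariantFunctionals

variable {F H : Type*} [Group F] [Group H]

/-- A homomorphism on a normal subgroup `N` of `F` is invariant if it is constant on `F`-conjugacy
classes, that is, if it factors through `N / [F, N]`. -/
def IsConjInvariant {A : Type*} [Group A] {N : Subgroup F} [N.Normal] (φ : N →* A) : Prop :=
  ∀ (f : F) (r : N), φ (MulAut.conjNormal f r) = φ r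

/-- The augmentation of the group ring of `H`, with its values reduced to a ring `K`. -/
noncomputable def augmentation (K H : Type*) [Ring K] [Group H] : MonoidAlgebra ℤ H →+* K :=
  (MonoidAlgebra.lift ℤ K H 1).toRingHom

theorem augmentation_of (K : Type*) [Ring K] (h : H) :
    augmentation K H (MonoidAlgebra.of ℤ H h) = 1 := by
  simp [augmentation]

instance (m : ℕ) : RingHomSurjective (augmentation (ZMod m) H) :=
  ⟨ZMod.ringHom_surjective _⟩

variable {π : F →* H} (hπ : Function.Surjective π) {K : Type*} [Ring K]

/-- The functional on the relation module induced by an invariant homomorphism on the kernel; it is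
linear over the augmentation because of the invariance. -/
noncomputable def relFunctional (φ : π.ker →* Multiplicative K) (hφ : IsConjInvariant φ) :
    RelMod π hπ →ₛₗ[augmentation K H] K where
  __ := (MonoidHom.toAdditiveLeft (Abelianization.lift φ)).comp
    (relationRep π hπ).asModuleEquiv.toAddEquiv.toAddMonoidHom
  map_smul' b v := by
    induction b using MonoidAlgebra.induction_on with
    | of h =>
      obtain ⟨f, rfl⟩ := hπ h
      obtain ⟨r, rfl⟩ := relClass_surjective π hπ v
      rw [← relClass_conj, augmentation_of, one_smul]
      exact congrArg Multiplicative.toAdd (hφ f r)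
    | add b c hb hc => rw [add_smul, map_add, add_smul, ← hb, ← hc]; exact map_add _ _ _
    | smul z b hb => rw [smul_assoc, map_zsmul, smul_assoc, ← hb]; exact map_zsmul _ _ _

theorem relFunctional_relClass (φ : π.ker →* Multiplicative K) (hφ : IsConjInvariant φ)
    (r : π.ker) : relFunctional hπ φ hφ (relClass π hπ r) = (φ r).toAdd := rfl

theorem card_le_spanRank_relMod {m : ℕ} [Nontrivial (ZMod m)] {κ : Type*} [Fintype κ]
    [DecidableEq κ] (φ : κ → π.ker →* Multiplicative (ZMod m)) (hφ : ∀ k, IsConjInvariant (φ k))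
    (r : κ → π.ker) (hr : ∀ k l, (φ k (r l)).toAdd = Pi.single (M := fun _ => ZMod m) l 1 k) :
    (Fintype.card κ : Cardinal) ≤
      (⊤ : Submodule (MonoidAlgebra ℤ H) (RelMod π hπ)).spanRank :=
  card_le_spanRank_of_dual (fun k => relFunctional hπ (φ k) (hφ k)) (fun l => relClass π hπ (r l))
    fun k l => by rw [relFunctional_relClass, hr]

end InvariantFunctionals

section FreeProduct

variable {ι : Type*} {F H : ι → Type*} [∀ i, Group (F i)] [∀ i, Group (H i)]
  {φ : ∀ i, F i →* H i}

theorem freeProdMap_of (i : ι) (f : F i) :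
    freeProdMap φ (Monoid.CoprodI.of f) = Monoid.CoprodI.of (φ i f) := by
  simp [freeProdMap]

theorem ker_freeProdMap (hφ : ∀ i, Function.Surjective (φ i)) {T : ∀ i, Set (F i)}
    (hT : ∀ i, (φ i).ker = Subgroup.normalClosure (T i)) :
    (freeProdMap φ).ker = Subgroup.normalClosure (⋃ i, Monoid.CoprodI.of '' T i) := by
  set N := Subgroup.normalClosure (⋃ i, Monoid.CoprodI.of '' T i)
  refine le_antisymm (fun f hf => ?_) (Subgroup.normalClosure_le_normal ?_)
  · have hle (i : ι) : (φ i).ker ≤ ((QuotientGroup.mk' N).comp Monoid.CoprodI.of).ker := by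
      rw [hT]
      refine Subgroup.normalClosure_le_normal fun t ht => (QuotientGroup.eq_one_iff _).2 ?_
      exact Subgroup.subset_normalClosure (Set.mem_iUnion.2 ⟨i, t, ht, rfl⟩)
    let s : Monoid.CoprodI H →* Monoid.CoprodI F ⧸ N :=
      Monoid.CoprodI.lift fun i => (φ i).liftOfSurjective (hφ i) ⟨_, hle i⟩
    have hs : s.comp (freeProdMap φ) = QuotientGroup.mk' N := by
      ext i f
      simp [s, freeProdMap_of]
    rw [← QuotientGroup.ker_mk' N, MonoidHom.mem_ker, ← hs, MonoidHom.comp_apply,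
      MonoidHom.mem_ker.1 hf, map_one]
  · refine Set.iUnion_subset fun i => ?_
    rintro _ ⟨t, ht, rfl⟩
    have htker : t ∈ (φ i).ker := hT i ▸ Subgroup.subset_normalClosure ht
    rw [SetLike.mem_coe, MonoidHom.mem_ker, freeProdMap_of, MonoidHom.mem_ker.1 htker, map_one]

variable [DecidableEq ι]

/-- The retraction of a free product onto its `i`-th factor that kills the other factors. -/
def freeProdProj (F : ι → Type*) [∀ i, Group (F i)] (i : ι) : Monoid.CoprodI F →* F i :=
  Monoid.CoprodI.lift (Pi.mulSingle i (MonoidHom.id (F i)))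

theorem freeProdProj_of_same (i : ι) (f : F i) :
    freeProdProj F i (Monoid.CoprodI.of f) = f :=
  Monoid.CoprodI.of_leftInverse i f

theorem freeProdProj_of_ne {i j : ι} (h : j ≠ i) (f : F j) :
    freeProdProj F i (Monoid.CoprodI.of f) = 1 := by
  rw [freeProdProj, Monoid.CoprodI.lift_of, Pi.mulSingle_eq_of_ne h, MonoidHom.one_apply]

theorem freeProdProj_freeProdMap (i : ι) (f : Monoid.CoprodI F) :
    freeProdProj H i (freeProdMap φ f) = φ i (freeProdProj F i f) := by
  refine DFunLike.congr_fun (f := (freeProdProj H i).comp (freeProdMap φ))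
    (g := (φ i).comp (freeProdProj F i)) ?_ f
  ext j g
  simp only [MonoidHom.comp_apply, freeProdMap_of]
  obtain rfl | hji := eq_or_ne j i
  · rw [freeProdProj_of_same, freeProdProj_of_same]
  · rw [freeProdProj_of_ne hji, freeProdProj_of_ne hji, map_one]

/-- The restriction of `freeProdProj` to the kernels of the presentations. -/
def kerProj (φ : ∀ i, F i →* H i) (i : ι) : (freeProdMap φ).ker →* (φ i).ker :=
  ((freeProdProj F i).comp (freeProdMap φ).ker.subtype).codRestrict _ fun r => by
    rw [MonoidHom.mem_ker, MonoidHom.comp_apply, Subgroup.coe_subtype, ← freeProdProj_freeProdMap,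
      MonoidHom.mem_ker.1 r.2, map_one]

/-- The inclusion of the kernel on one factor into the kernel on the free product. -/
def kerOf (φ : ∀ i, F i →* H i) (i : ι) : (φ i).ker →* (freeProdMap φ).ker :=
  (Monoid.CoprodI.of.comp (φ i).ker.subtype).codRestrict _ fun r => by
    rw [MonoidHom.mem_ker, MonoidHom.comp_apply, Subgroup.coe_subtype, freeProdMap_of,
      MonoidHom.mem_ker.1 r.2, map_one]

theorem kerProj_kerOf_same (i : ι) (r : (φ i).ker) : kerProj φ i (kerOf φ i r) = r :=
  Subtype.ext (freeProdProj_of_same i (r : F i))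

theorem kerProj_kerOf_ne {i j : ι} (h : j ≠ i) (r : (φ j).ker) :
    kerProj φ i (kerOf φ j r) = 1 :=
  Subtype.ext (freeProdProj_of_ne h (r : F j))

theorem IsConjInvariant.comp_kerProj {A : Type*} [Group A] {i : ι} {ψ : (φ i).ker →* A}
    (hψ : IsConjInvariant ψ) : IsConjInvariant (ψ.comp (kerProj φ i)) := fun f r => by
  have hconj : kerProj φ i (MulAut.conjNormal f r) =
      MulAut.conjNormal (freeProdProj F i f) (kerProj φ i r) := by
    ext
    simp [kerProj]
  rw [MonoidHom.comp_apply, hconj, hψ, MonoidHom.comp_apply]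

end FreeProduct

section NaturalPresentation

/-- The exponent sum of the letter `k` in a word. -/
def exponentSum {α : Type*} [DecidableEq α] (k : α) : FreeGroup α →* Multiplicative ℤ :=
  FreeGroup.lift (Pi.mulSingle k (Multiplicative.ofAdd 1))

theorem map_eq_zpow_exponentSum_mul {K : Type*} [Group K] {g : FreeGroup (Fin 2) →* K}
    (hg : Commute (g (FreeGroup.of 0)) (g (FreeGroup.of 1))) (f : FreeGroup (Fin 2)) :
    g f = g (FreeGroup.of 0) ^ (exponentSum 0 f).toAdd *
      g (FreeGroup.of 1) ^ (exponentSum 1 f).toAdd := by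
  let g' : FreeGroup (Fin 2) →* K := MonoidHom.mk' (fun f => g (FreeGroup.of 0) ^
      (exponentSum 0 f).toAdd * g (FreeGroup.of 1) ^ (exponentSum 1 f).toAdd) fun u v => by
    simp only [map_mul, toAdd_mul, zpow_add]
    exact (hg.zpow_zpow _ _).mul_mul_mul_comm _ _
  suffices h : g = g' from DFunLike.congr_fun h f
  ext k
  fin_cases k <;> simp [g', exponentSum]

variable {G C : Type*} [Group G] [Group C] {a : G} {c : C}

theorem naturalPres_apply (f : FreeGroup (Fin 2)) :
    naturalPres a c f = (a ^ (exponentSum 0 f).toAdd, c ^ (exponentSum 1 f).toAdd) := by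
  rw [map_eq_zpow_exponentSum_mul (by simp [naturalPres, commute_iff_eq])]
  simp [naturalPres]

theorem mem_ker_naturalPres {f : FreeGroup (Fin 2)} :
    f ∈ (naturalPres a c).ker ↔
      (orderOf a : ℤ) ∣ (exponentSum 0 f).toAdd ∧ (orderOf c : ℤ) ∣ (exponentSum 1 f).toAdd := by
  rw [MonoidHom.mem_ker, naturalPres_apply, Prod.mk_eq_one, orderOf_dvd_iff_zpow_eq_one,
    orderOf_dvd_iff_zpow_eq_one]

variable (a c)

theorem pow_orderOf_mem_ker_naturalPres :
    FreeGroup.of (0 : Fin 2) ^ orderOf a ∈ (naturalPres a c).ker := by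
  simp [naturalPres, pow_orderOf_eq_one]

theorem commutator_mem_ker_naturalPres :
    ⁅FreeGroup.of (0 : Fin 2), FreeGroup.of 1⁆ ∈ (naturalPres a c).ker := by
  rw [MonoidHom.mem_ker, map_commutatorElement, commutatorElement_eq_one_iff_commute]
  simp [naturalPres, commute_iff_eq]

variable {a c}

theorem ker_naturalPres (hc : orderOf c = 0) :
    (naturalPres a c).ker = Subgroup.normalClosure
      {FreeGroup.of 0 ^ orderOf a, ⁅FreeGroup.of (0 : Fin 2), FreeGroup.of 1⁆} := by
  set T : Set (FreeGroup (Fin 2)) :=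
    {FreeGroup.of 0 ^ orderOf a, ⁅FreeGroup.of (0 : Fin 2), FreeGroup.of 1⁆}
  refine le_antisymm (fun f hf => ?_) (Subgroup.normalClosure_le_normal ?_)
  · let q := QuotientGroup.mk' (Subgroup.normalClosure T)
    have hq {t : FreeGroup (Fin 2)} (ht : t ∈ T) : q t = 1 :=
      (QuotientGroup.eq_one_iff t).2 (Subgroup.subset_normalClosure ht)
    have hpow : q (FreeGroup.of 0) ^ orderOf a = 1 := by
      rw [← map_pow, hq (Set.mem_insert _ _)]
    have hcomm : Commute (q (FreeGroup.of 0)) (q (FreeGroup.of 1)) := by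
      rw [← commutatorElement_eq_one_iff_commute, ← map_commutatorElement,
        hq (Set.mem_insert_of_mem _ rfl)]
    obtain ⟨⟨k, hk⟩, hf1⟩ := mem_ker_naturalPres.1 hf
    rw [hc, Nat.cast_zero, zero_dvd_iff] at hf1
    rw [← QuotientGroup.ker_mk' (Subgroup.normalClosure T), MonoidHom.mem_ker]
    change q f = 1
    rw [map_eq_zpow_exponentSum_mul hcomm, hk, hf1, zpow_mul, zpow_natCast, hpow, one_zpow,
      zpow_zero, one_mul]
  · rintro _ (rfl | rfl)
    · exact pow_orderOf_mem_ker_naturalPres a c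
    · exact commutator_mem_ker_naturalPres a c

end NaturalPresentation

/-- The Heisenberg group over a ring: upper unitriangular matrices of size three, given by their
entries above the diagonal. -/
@[ext]
structure Heisenberg (K : Type*) where
  /-- The entry in the first row and second column. -/
  fst : K
  /-- The entry in the second row and third column. -/
  snd : K
  /-- The entry in the first row and third column. -/
  corner : K

namespace Heisenberg

variable {K : Type*} [Ring K]

instance : Mul (Heisenberg K) :=
  ⟨fun u v => ⟨u.fst + v.fst, u.snd + v.snd, u.corner + v.corner + u.fst * v.snd⟩⟩

instance : One (Heisenberg K) := ⟨⟨0, 0, 0⟩⟩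

instance : Inv (Heisenberg K) := ⟨fun u => ⟨-u.fst, -u.snd, u.fst * u.snd - u.corner⟩⟩

@[simp] theorem mul_fst (u v : Heisenberg K) : (u * v).fst = u.fst + v.fst := rfl
@[simp] theorem mul_snd (u v : Heisenberg K) : (u * v).snd = u.snd + v.snd := rfl
@[simp] theorem mul_corner (u v : Heisenberg K) :
    (u * v).corner = u.corner + v.corner + u.fst * v.snd := rfl
@[simp] theorem one_fst : (1 : Heisenberg K).fst = 0 := rfl
@[simp] theorem one_snd : (1 : Heisenberg K).snd = 0 := rfl
@[simp] theorem one_corner : (1 : Heisenberg K).corner = 0 := rfl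
@[simp] theorem inv_fst (u : Heisenberg K) : u⁻¹.fst = -u.fst := rfl
@[simp] theorem inv_snd (u : Heisenberg K) : u⁻¹.snd = -u.snd := rfl
@[simp] theorem inv_corner (u : Heisenberg K) : u⁻¹.corner = u.fst * u.snd - u.corner := rfl

instance : Group (Heisenberg K) :=
  Group.ofLeftAxioms
    (fun u v w => by
      ext
      · exact add_assoc _ _ _
      · exact add_assoc _ _ _
      · simp only [mul_corner, mul_fst, mul_snd]
        noncomm_ring)
    (fun u => by ext <;> simp) (fun u => by ext <;> simp)

/-- The projection to the entry in the first row and second column. -/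
def fstHom : Heisenberg K →* Multiplicative K where
  toFun u := Multiplicative.ofAdd u.fst
  map_one' := rfl
  map_mul' _ _ := rfl

/-- The projection to the entry in the second row and third column. -/
def sndHom : Heisenberg K →* Multiplicative K where
  toFun u := Multiplicative.ofAdd u.snd
  map_one' := rfl
  map_mul' _ _ := rfl

theorem corner_conj {u : Heisenberg K} (hfst : u.fst = 0) (hsnd : u.snd = 0) (v : Heisenberg K) :
    (v * u * v⁻¹).corner = u.corner := by
  simp only [mul_corner, mul_fst, inv_snd, inv_corner, hfst, hsnd]
  noncomm_ring

theorem corner_pow_of_snd_eq_zero {u : Heisenberg K} (hsnd : u.snd = 0) (k : ℕ) :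
    (u ^ k).corner = k • u.corner := by
  induction k with
  | zero => rw [pow_zero, one_corner, zero_smul]
  | succ k ih => rw [pow_succ, mul_corner, ih, hsnd, mul_zero, add_zero, succ_nsmul]

end Heisenberg

section RelatorFunctionals

/-- The representation of the free group on two letters by elementary matrices. -/
def toHeisenberg (K : Type*) [Ring K] : FreeGroup (Fin 2) →* Heisenberg K :=
  FreeGroup.lift ![⟨1, 0, 0⟩, ⟨0, 1, 0⟩]

variable {K : Type*} [Ring K]

theorem fst_toHeisenberg (f : FreeGroup (Fin 2)) :
    (toHeisenberg K f).fst = ((exponentSum 0 f).toAdd : K) := by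
  refine DFunLike.congr_fun (f := Heisenberg.fstHom.comp (toHeisenberg K))
    (g := (Int.castAddHom K).toMultiplicative.comp (exponentSum 0)) ?_ f
  ext k
  fin_cases k <;> simp [toHeisenberg, Heisenberg.fstHom, exponentSum]

theorem snd_toHeisenberg (f : FreeGroup (Fin 2)) :
    (toHeisenberg K f).snd = ((exponentSum 1 f).toAdd : K) := by
  refine DFunLike.congr_fun (f := Heisenberg.sndHom.comp (toHeisenberg K))
    (g := (Int.castAddHom K).toMultiplicative.comp (exponentSum 1)) ?_ f
  ext k
  fin_cases k <;> simp [toHeisenberg, Heisenberg.sndHom, exponentSum]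

variable {G C : Type*} [Group G] [Group C] (a : G) (c : C)

/-- The relator `x ^ orderOf a` of the natural presentation. -/
noncomputable def powRelator : (naturalPres a c).ker :=
  ⟨FreeGroup.of 0 ^ orderOf a, pow_orderOf_mem_ker_naturalPres a c⟩

/-- The relator `⁅x, y⁆` of the natural presentation. -/
def commutatorRelator : (naturalPres a c).ker :=
  ⟨⁅FreeGroup.of 0, FreeGroup.of 1⁆, commutator_mem_ker_naturalPres a c⟩

variable (K) in
/-- The exponent sum of the first letter in a relator, divided by the order of `a`, with its values
reduced to `K`. -/
noncomputable def exponentFunctional : (naturalPres a c).ker →* Multiplicative K :=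
  MonoidHom.mk' (fun r => Multiplicative.ofAdd
    (((exponentSum 0 (r : FreeGroup (Fin 2))).toAdd / orderOf a : ℤ) : K)) fun r s => by
      simp [Int.add_ediv_of_dvd_left (mem_ker_naturalPres.1 r.2).1]

theorem isConjInvariant_exponentFunctional : IsConjInvariant (exponentFunctional K a c) :=
  fun f r => by
    simp [exponentFunctional]

theorem exponentFunctional_powRelator (ha : orderOf a ≠ 0) :
    (exponentFunctional K a c (powRelator a c)).toAdd = 1 := by
  simp [exponentFunctional, powRelator, exponentSum, ha]

theorem exponentFunctional_commutatorRelator :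
    (exponentFunctional K a c (commutatorRelator a c)).toAdd = 0 := by
  have h : exponentSum 0 ⁅FreeGroup.of (0 : Fin 2), FreeGroup.of (1 : Fin 2)⁆ = 1 := by
    rw [map_commutatorElement, commutatorElement_eq_one_iff_commute]
    exact Commute.all _ _
  simp [exponentFunctional, commutatorRelator, h, -map_commutatorElement]

variable {a c}

theorem fst_toHeisenberg_eq_zero (ha : (orderOf a : K) = 0) (r : (naturalPres a c).ker) :
    (toHeisenberg K r).fst = 0 := by
  obtain ⟨k, hk⟩ := (mem_ker_naturalPres.1 r.2).1
  rw [fst_toHeisenberg, hk, Int.cast_mul, Int.cast_natCast, ha, zero_mul]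

theorem snd_toHeisenberg_eq_zero (hc : (orderOf c : K) = 0) (r : (naturalPres a c).ker) :
    (toHeisenberg K r).snd = 0 := by
  obtain ⟨k, hk⟩ := (mem_ker_naturalPres.1 r.2).2
  rw [snd_toHeisenberg, hk, Int.cast_mul, Int.cast_natCast, hc, zero_mul]

/-- The corner entry of the Heisenberg representation, which is additive on relators because their
first off-diagonal vanishes. -/
def cornerFunctional (ha : (orderOf a : K) = 0) : (naturalPres a c).ker →* Multiplicative K :=
  MonoidHom.mk' (fun r => Multiplicative.ofAdd (toHeisenberg K r).corner) fun r s => by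
    simp [fst_toHeisenberg_eq_zero ha r]

theorem isConjInvariant_cornerFunctional (ha : (orderOf a : K) = 0) (hc : (orderOf c : K) = 0) :
    IsConjInvariant (cornerFunctional (c := c) ha) := fun f r => by
  refine congrArg Multiplicative.ofAdd ?_
  rw [MulAut.conjNormal_apply, map_mul, map_mul, map_inv]
  exact Heisenberg.corner_conj (fst_toHeisenberg_eq_zero ha r) (snd_toHeisenberg_eq_zero hc r) _

theorem cornerFunctional_powRelator (ha : (orderOf a : K) = 0) :
    (cornerFunctional ha (powRelator a c)).toAdd = 0 := by
  simp [cornerFunctional, powRelator, toHeisenberg, Heisenberg.corner_pow_of_snd_eq_zero]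

theorem cornerFunctional_commutatorRelator (ha : (orderOf a : K) = 0) :
    (cornerFunctional ha (commutatorRelator a c)).toAdd = 1 := by
  simp [cornerFunctional, commutatorRelator, toHeisenberg, commutatorElement_def]

end RelatorFunctionals

section NaturalFreeProduct

variable {ι : Type*} [Fintype ι] {G C : ι → Type*} [∀ i, Group (G i)] [∀ i, Group (C i)]
  {a : ∀ i, G i} {c : ∀ i, C i} (hnat : ∀ i, Function.Surjective (naturalPres (a i) (c i)))

theorem spanRank_relMod_freeProdMap_naturalPres_le (hc : ∀ i, orderOf (c i) = 0)
    (hcop : Pairwise fun i j => (orderOf (a i)).Coprime (orderOf (a j))) :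
    (⊤ : Submodule (MonoidAlgebra ℤ (Monoid.CoprodI fun i => G i × C i))
      (RelMod _ (freeProdMap_surjective hnat))).spanRank ≤
        ((Fintype.card ι + 1 : ℕ) : Cardinal) := by
  refine spanRank_relMod_le _ (x := fun i => Monoid.CoprodI.of (i := i) (FreeGroup.of 0))
    (y := fun i => Monoid.CoprodI.of (i := i) (FreeGroup.of 1)) hcop ?_
  simp only [ker_freeProdMap hnat fun i => ker_naturalPres (hc i), Set.image_pair, map_pow,
    map_commutatorElement]

theorem card_add_one_le_spanRank_relMod_freeProdMap_naturalPres (ha : ∀ i, orderOf (a i) ≠ 0)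
    {i₀ : ι} (ha₀ : orderOf (a i₀) ≠ 1) (hc₀ : orderOf (a i₀) ∣ orderOf (c i₀)) :
    ((Fintype.card ι + 1 : ℕ) : Cardinal) ≤
      (⊤ : Submodule (MonoidAlgebra ℤ (Monoid.CoprodI fun i => G i × C i))
        (RelMod _ (freeProdMap_surjective hnat))).spanRank := by
  classical
  have : Nontrivial (ZMod (orderOf (a i₀))) := ZMod.nontrivial_iff.2 ha₀
  have ha_zero : (orderOf (a i₀) : ZMod (orderOf (a i₀))) = 0 := ZMod.natCast_self _
  have hc_zero : (orderOf (c i₀) : ZMod (orderOf (a i₀))) = 0 :=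
    (ZMod.natCast_eq_zero_iff _ _).2 hc₀
  let P (i : ι) := naturalPres (a i) (c i)
  let φ (o : Option ι) : (freeProdMap P).ker →* Multiplicative (ZMod (orderOf (a i₀))) :=
    o.elim ((cornerFunctional ha_zero).comp (kerProj P i₀)) fun i =>
      (exponentFunctional _ (a i) (c i)).comp (kerProj P i)
  let r (o : Option ι) : (freeProdMap P).ker :=
    o.elim (kerOf P i₀ (commutatorRelator _ _)) fun i => kerOf P i (powRelator _ _)
  have hφ (o : Option ι) : IsConjInvariant (φ o) := match o with
    | none => (isConjInvariant_cornerFunctional ha_zero hc_zero).comp_kerProj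
    | some i => (isConjInvariant_exponentFunctional (a i) (c i)).comp_kerProj
  rw [← Fintype.card_option]
  refine card_le_spanRank_relMod _ φ hφ r fun o p => ?_
  obtain _ | i := o <;> obtain _ | j := p
  · simp [φ, r, kerProj_kerOf_same, cornerFunctional_commutatorRelator]
  · obtain rfl | hj := eq_or_ne j i₀
    · simp [φ, r, kerProj_kerOf_same, cornerFunctional_powRelator]
    · simp [φ, r, kerProj_kerOf_ne hj]
  · obtain rfl | hi := eq_or_ne i₀ i
    · simp [φ, r, kerProj_kerOf_same, exponentFunctional_commutatorRelator]
    · simp [φ, r, kerProj_kerOf_ne hi]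
  · obtain rfl | hj := eq_or_ne j i
    · simp [φ, r, kerProj_kerOf_same, exponentFunctional_powRelator _ _ (ha j)]
    · simp [φ, r, kerProj_kerOf_ne hj, hj.symm]

end NaturalFreeProduct

end RelationModule

/-- `Submodule.spanRank ⊤` is the least cardinality of a generating set of the module. -/
theorem theorem2p3 (n : ℕ) (hn : 0 < n) (G C : Fin n → Type*)
    [∀ i, Group (G i)] [∀ i, Finite (G i)] [∀ i, Nontrivial (G i)]
    [∀ i, Group (C i)] [∀ i, Infinite (C i)]
    (a : ∀ i, G i) (ha : ∀ i, Subgroup.zpowers (a i) = ⊤)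
    (c : ∀ i, C i) (hc : ∀ i, Subgroup.zpowers (c i) = ⊤)
    (hcop : Pairwise fun i j => (Nat.card (G i)).Coprime (Nat.card (G j))) :
    Submodule.spanRank
      (⊤ : Submodule (MonoidAlgebra ℤ (Monoid.CoprodI fun i => G i × C i))
        (RelationModule.RelMod
          (RelationModule.freeProdMap fun i => RelationModule.naturalPres (a i) (c i))
          (RelationModule.freeProdMap_surjective fun i =>
            RelationModule.naturalPres_surjective (ha i) (hc i)))) =
      ((n + 1 : ℕ) : Cardinal) := by
  have ha_card (i : Fin n) : orderOf (a i) = Nat.card (G i) :=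
    orderOf_eq_card_of_forall_mem_zpowers ((Subgroup.eq_top_iff' _).1 (ha i))
  have hc_zero (i : Fin n) : orderOf (c i) = 0 :=
    Infinite.orderOf_eq_zero_of_forall_mem_zpowers ((Subgroup.eq_top_iff' _).1 (hc i))
  have hnat (i : Fin n) := RelationModule.naturalPres_surjective (ha i) (hc i)
  conv_rhs => rw [← Fintype.card_fin n]
  refine le_antisymm ?_ ?_
  · refine RelationModule.spanRank_relMod_freeProdMap_naturalPres_le hnat hc_zero ?_
    simpa only [ha_card] using hcop
  · refine RelationModule.card_add_one_le_spanRank_relMod_freeProdMap_naturalPres hnat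
      (fun i => ha_card i ▸ Nat.card_pos.ne') (i₀ := ⟨0, hn⟩) ?_ ?_
    · rw [ha_card]
      exact Finite.one_lt_card.ne'
    · rw [hc_zero]
      exact dvd_zero _
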